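/- For $\alpha=\sum_{k\ge -h}a_kt^{-k}\in\mathbb{Q}((t^{-1}))$ with $a_{-h}\ne 0$ put $|\alpha|=2^h$, put $|0|=0$, and let $\|\alpha\|=\min_{p\in\mathbb{Q}[t]}|\alpha-p|$. The $t$-adic Littlewood conjecture ($t$-LC) for $\alpha$ is the assertion that $\inf_{q\in\mathbb{Q}[t]\setminus\{0\},\,k\ge0}|q|\cdot\|qt^k\alpha\|=0$. Let $\mathrm{ELC}$ be the set of $\alpha$ for which this infimum is positive, and for $\delta>0$ let $\mathrm{ELC}_\delta$ be the set of $\alpha$ for which it is at least $\delta$. Let $\mathrm{BAD}_\delta$ be the set of $\alpha$ with $\liminf_{q\in\mathbb{Q}[t],\,\deg q\to\infty}|q|\cdot\|q\alpha\|\ge\delta$. For $u\in\mathbb{Q}$ let $g_u(t)=t^{-1}\prod_{i\ge0}(1+ut^{-2^i})\in\mathbb{Q}((t^{-1}))$, a solution of $g(t)=(t+u)\,g(t^2)$, and let $a_k(u)$ denote the coefficient of $t^{-k}$ in $g_u$. (1) For every $u\in\mathbb{Q}\setminus\{0,1,-1\}$ one has $g_u\in\mathrm{ELC}_{1/2}$;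 in particular $g_u$ is a counterexample to $t$-LC. (2) For $u=-1$ (the Thue--Morse series), $g_{-1}\in\mathrm{BAD}_{1/2}$ and $g_{-1}\notin\mathrm{ELC}$, that is, $g_{-1}$ is badly approximable with constant $1/2$ but satisfies $t$-LC. (3) For all integers $n\ge1$ and $l\ge0$ there is a polynomial $D_{n,l}\in\mathbb{Z}[X]$ such that the Hankel determinant $\det\big(a_{n+i+j}(u)\big)_{0\le i,j\le l}$ equals $D_{n,l}(u)$ for all $u\in\mathbb{Q}$. The leading coefficient and the lowest non-zero coefficient of $D_{n,l}$ are both $\pm1$, and $\deg D_{n,l}=\sigma(l)+\sigma(n+l-1)-\sigma(n-2)$. Here $\sigma(m)=\sum_{i=1}^m\tau_2(i)$, where $\tau_2(i)$ is the number of ones in the binary expansion of $i$, and $\sigma(m)=0$ for $m\le0$. -/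

import Mathlib

/-! The field `F((t⁻¹))` is `LaurentSeries F`, whose variable plays the role of `t⁻¹`: the
coefficient with index `k` of `α : LaurentSeries F` is the coefficient of `t ^ (-k)`. -/

namespace TAdicLittlewood

noncomputable section

open Polynomial

/-- The element `t` of `F((t⁻¹))`. -/
def tVar (F : Type*) [CommRing F] : LaurentSeries F := HahnSeries.single (-1 : ℤ) 1

/-- The embedding of `F[t]` into `F((t⁻¹))`. -/
def ofPoly {F : Type*} [CommRing F] (q : F[X]) : LaurentSeries F := aeval (tVar F) q

open Classical in
/-- The absolute value of `α = ∑_{k ≥ -h} a_k t^{-k}` with `a_{-h} ≠ 0` is `2 ^ h`;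
and `|0| = 0`. -/
def absVal {F : Type*} [CommRing F] (α : LaurentSeries F) : ℝ :=
  if α = 0 then 0 else (2 : ℝ) ^ (-α.order)

/-- The distance `‖α‖` from `α` to the nearest polynomial in `t`. -/
def distPoly {F : Type*} [CommRing F] (α : LaurentSeries F) : ℝ :=
  ⨅ p : F[X], absVal (α - ofPoly p)

/-- The infimum of `|q| ⬝ ‖q t ^ k α‖` over all `q ∈ F[t] \ {0}` and `k ≥ 0`. -/
def littlewoodInf {F : Type*} [Field F] (α : LaurentSeries F) : ℝ :=
  ⨅ x : {q : F[X] // q ≠ 0} × ℕ,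
    absVal (ofPoly x.1.1) * distPoly (ofPoly x.1.1 * tVar F ^ x.2 * α)

/-- The set of exceptions to the `t`-adic Littlewood conjecture. -/
def ELC (F : Type*) [Field F] : Set (LaurentSeries F) :=
  {α | 0 < littlewoodInf α}

/-- The exceptions to the `t`-adic Littlewood conjecture with constant `δ`. -/
def ELCδ (F : Type*) [Field F] (δ : ℝ) : Set (LaurentSeries F) :=
  {α | α ∈ ELC F ∧ δ ≤ littlewoodInf α}

/-- The lower limit of `|q| ⬝ ‖q α‖` as `q` runs through `F[t]` with `|q| → ∞`, that is
`deg q → ∞`. It is taken in the extended reals, where it always exists. -/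
def badLiminf {F : Type*} [Field F] (α : LaurentSeries F) : EReal :=
  Filter.liminf (fun q : F[X] => ((absVal (ofPoly q) * distPoly (ofPoly q * α) : ℝ) : EReal))
    (Filter.comap (fun q : F[X] => q.natDegree) Filter.atTop)

/-- The badly approximable series with constant `δ`. -/
def Badδ (F : Type*) [Field F] (δ : ℝ) : Set (LaurentSeries F) :=
  {α | (δ : EReal) ≤ badLiminf α}

/-- The infinite product `∏_{i ≥ 0} (1 + u x ^ (2 ^ i))` as a formal power series: since
`2 ^ i > m` for `i > m`, the coefficient of `x ^ m` is that of the product of the factors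
with `i ≤ m`. -/
def prodSeries {R : Type*} [CommRing R] (u : R) : PowerSeries R :=
  PowerSeries.mk fun m => PowerSeries.coeff m
    (∏ i ∈ Finset.range (m + 1), (1 + PowerSeries.C u * PowerSeries.X ^ (2 ^ i)))

/-- The generalised Thue-Morse function `g_u(t) = t⁻¹ ∏_{i ≥ 0} (1 + u t ^ (- 2 ^ i))`. -/
def gTM {R : Type*} [CommRing R] (u : R) : LaurentSeries R :=
  HahnSeries.single (1 : ℤ) 1 * HahnSeries.ofPowerSeries ℤ R (prodSeries u)

/-- The Hankel matrix `H_α(n, l) = (a_{n + i + j})_{0 ≤ i, j ≤ l}`. -/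
def hankel {F : Type*} [CommRing F] (α : LaurentSeries F) (n : ℤ) (l : ℕ) :
    Matrix (Fin (l + 1)) (Fin (l + 1)) F :=
  Matrix.of fun i j => α.coeff (n + (i : ℕ) + (j : ℕ))

/-- The number of ones in the binary expansion of `n`. -/
def binOnes (n : ℕ) : ℕ := (Nat.digits 2 n).sum

/-- `σ(n) = ∑_{1 ≤ i ≤ n} τ₂(i)`, which is `0` for all integers `n ≤ 0`. -/
def sigmaOnes (n : ℤ) : ℕ := ∑ i ∈ Finset.Icc 1 n.toNat, binOnes i

/-- An integer polynomial whose leading and lowest non-zero coefficients are both `1` or `-1`. -/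
def DoublyMonic (D : ℤ[X]) : Prop :=
  (D.leadingCoeff = 1 ∨ D.leadingCoeff = -1) ∧ (D.trailingCoeff = 1 ∨ D.trailingCoeff = -1)

/-! The series `gTM u` is indeed the infinite product and solves `g(t) = (t + u) g(t²)`. -/

theorem coeff_prod_range_succ {R : Type*} [CommRing R] (u : R) {m N : ℕ} (h : m < N) :
    PowerSeries.coeff m (∏ i ∈ Finset.range (N + 1),
      (1 + PowerSeries.C u * PowerSeries.X ^ (2 ^ i))) =
    PowerSeries.coeff m (∏ i ∈ Finset.range N,
      (1 + PowerSeries.C u * PowerSeries.X ^ (2 ^ i))) := by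
  have h2 : m < 2 ^ N := h.trans Nat.lt_two_pow_self
  rw [Finset.prod_range_succ, mul_add, mul_one, map_add, ← mul_assoc,
    PowerSeries.coeff_mul_X_pow', if_neg (by omega), add_zero]

theorem coeff_prodSeries {R : Type*} [CommRing R] (u : R) {m N : ℕ} (h : m < N) :
    PowerSeries.coeff m (prodSeries u) =
    PowerSeries.coeff m (∏ i ∈ Finset.range N,
      (1 + PowerSeries.C u * PowerSeries.X ^ (2 ^ i))) := by
  induction N, h using Nat.le_induction with
  | base => simp [prodSeries]
  | succ N hN ih => rw [ih, coeff_prod_range_succ u hN]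

/-- The substitution `g(t) ↦ g(t²)` on `F((t⁻¹))`. -/
def substSq (R : Type*) [CommRing R] : LaurentSeries R →+* LaurentSeries R :=
  HahnSeries.embDomainRingHom (AddMonoidHom.mulLeft (2 : ℤ))
    (fun a b h => by simpa using h) (fun a b => by simp)

theorem substSq_single (R : Type*) [CommRing R] (n : ℤ) (r : R) :
    substSq R (HahnSeries.single n r) = HahnSeries.single (2 * n) r := by
  simp [substSq, HahnSeries.embDomainRingHom, HahnSeries.embDomain_single]

theorem substSq_ofPowerSeries {R : Type*} [CommRing R] (f : PowerSeries R) :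
    substSq R (HahnSeries.ofPowerSeries ℤ R f) =
      HahnSeries.ofPowerSeries ℤ R (PowerSeries.expand 2 two_ne_zero f) := by
  ext n
  by_cases hn : ∃ m : ℤ, n = 2 * m
  · obtain ⟨m, rfl⟩ := hn
    have h1 : (substSq R (HahnSeries.ofPowerSeries ℤ R f)).coeff (2 * m) =
        (HahnSeries.ofPowerSeries ℤ R f).coeff m :=
      HahnSeries.embDomain_coeff (a := m)
    rw [h1, PowerSeries.coeff_coe, PowerSeries.coeff_coe]
    by_cases hm : m < 0
    · rw [if_pos hm, if_pos (by omega)]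
    · rw [if_neg hm, if_neg (by omega), Int.natAbs_mul]
      exact (PowerSeries.coeff_expand_mul 2 two_ne_zero f _).symm
  · have h1 : (substSq R (HahnSeries.ofPowerSeries ℤ R f)).coeff n = 0 :=
      HahnSeries.embDomain_of_notMem_range (by rintro ⟨m, hm⟩; exact hn ⟨m, hm.symm⟩)
    rw [h1, PowerSeries.coeff_coe, PowerSeries.coeff_expand_of_not_dvd, ite_self]
    intro h
    exact hn (Int.natCast_dvd.2 h)

theorem prodSeries_functional {R : Type*} [CommRing R] (u : R) :
    prodSeries u = (1 + PowerSeries.C u * PowerSeries.X) *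
      PowerSeries.expand 2 two_ne_zero (prodSeries u) := by
  have key : ∀ N : ℕ, (∏ i ∈ Finset.range (N + 1),
      (1 + PowerSeries.C u * PowerSeries.X ^ (2 ^ i))) =
      (1 + PowerSeries.C u * PowerSeries.X) * PowerSeries.expand 2 two_ne_zero
        (∏ i ∈ Finset.range N, (1 + PowerSeries.C u * PowerSeries.X ^ (2 ^ i))) := by
    intro N
    rw [Finset.prod_range_succ', mul_comm, map_prod]
    congr 1
    · simp
    · refine Finset.prod_congr rfl fun i _ => ?_
      rw [map_add, map_one, map_mul, PowerSeries.expand_C, map_pow, PowerSeries.expand_X,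
        ← pow_mul, pow_succ']
  ext m
  rw [coeff_prodSeries u (show m < m + 1 + 1 by omega), key, PowerSeries.coeff_mul,
    PowerSeries.coeff_mul]
  refine Finset.sum_congr rfl fun p hp => ?_
  rw [PowerSeries.coeff_expand, PowerSeries.coeff_expand]
  have hp' := Finset.HasAntidiagonal.mem_antidiagonal.1 hp
  rw [coeff_prodSeries u (show p.2 / 2 < m + 1 by omega)]

theorem gTM_functional {R : Type*} [CommRing R] (u : R) :
    gTM u = (tVar R + HahnSeries.C u) * substSq R (gTM u) := by
  have h : (tVar R + HahnSeries.C u) * HahnSeries.single (2 * 1 : ℤ) 1 =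
      HahnSeries.single (1 : ℤ) 1 *
        HahnSeries.ofPowerSeries ℤ R (1 + PowerSeries.C u * PowerSeries.X) := by
    have e : HahnSeries.ofPowerSeries ℤ R (1 + PowerSeries.C u * PowerSeries.X) =
        1 + HahnSeries.C u * HahnSeries.single (1 : ℤ) 1 := by
      rw [RingHom.map_add, RingHom.map_one, RingHom.map_mul, HahnSeries.ofPowerSeries_C,
        HahnSeries.ofPowerSeries_X]
    have e2 : (HahnSeries.single (2 * 1 : ℤ) 1 : LaurentSeries R) =
        HahnSeries.single (1 : ℤ) 1 * HahnSeries.single (1 : ℤ) 1 := by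
      rw [HahnSeries.single_mul_single]; norm_num
    have e3 : tVar R * HahnSeries.single (1 : ℤ) 1 = 1 := by
      rw [tVar, HahnSeries.single_mul_single]; norm_num
    rw [e, e2]
    linear_combination HahnSeries.single (1 : ℤ) 1 * e3
  rw [gTM, map_mul, substSq_single, substSq_ofPowerSeries, ← mul_assoc, h, mul_assoc,
    ← map_mul, ← prodSeries_functional]

end

end TAdicLittlewood

open TAdicLittlewood

/-! The coefficient of `t ^ (-m - 1)` in `g_u` is `u ^ τ₂(m)`, so its Hankel determinants are the
values at `u` of `D = det (X ^ τ₂(m + i + j))`. By subadditivity of `τ₂` every exponent is at most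
`τ₂(m + i) + τ₂(j)`. This bounds the degree of `D`, and the coefficient at the bound is the
determinant of the 0/1 matrix that records for which pairs `m + i` and `j` have disjoint binary
digits. Sorting rows and columns by parity shows that this matrix has trivial kernel over every ring
(`eq_zero_of_noCarry_kernel`), so its determinant is `±1`. Since `τ₂(2 ^ k - 1 - x) = k - τ₂(x)`,
reflecting `D` gives another determinant of the same family, and the lowest coefficient is
also `±1` (`reflect_det_genHankel`).

A rational root of such a polynomial is `0`, `1` or `-1`. For all other `u` no Hankel determinant
vanishes, which says that `‖q t ^ k g_u‖ ≥ 2 ^ (-deg q - 1)` for all `q ≠ 0` and `k`.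

For `u = -1` the coefficients are the Thue–Morse signs. Arbitrarily long blocks
`V V̄ V V̄` in this word give approximations with denominators `t ^ h + 1` that force the infimum to
be `0` (`littlewoodInf_thueMorse_le`).
On the other hand, let `q` violate `‖q g_u‖ ≥ 2 ^ (-deg q - 1)`. Scaled to a primitive integer
polynomial and reduced modulo two, after halving the differences of consecutive linear equations for
its coefficients, it would be too good a denominator for the series `A` over the field with two
elements with `A ^ 2 + A = 1 / (t + 1)`. The norm form of the quadratic extension generated by `A`
is anisotropic by an Eisenstein argument, which excludes such approximations
(`eq_zero_of_pdSeries_approx`). -/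

namespace TAdicLittlewood

open Polynomial

/-! ### Binary digit sums -/

theorem binOnes_zero : binOnes 0 = 0 := by simp [binOnes]

theorem binOnes_two_mul (n : ℕ) : binOnes (2 * n) = binOnes n := by
  rcases Nat.eq_zero_or_pos n with rfl | h
  · rfl
  · rw [binOnes, Nat.digits_def' (by norm_num) (by omega), binOnes]
    simp

theorem binOnes_two_mul_add_one (n : ℕ) : binOnes (2 * n + 1) = binOnes n + 1 := by
  rw [binOnes, Nat.digits_def' (by norm_num) (by omega), binOnes, List.sum_cons,
    show (2 * n + 1) % 2 = 1 by omega, show (2 * n + 1) / 2 = n by omega, add_comm]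

theorem binOnes_one : binOnes 1 = 1 := by simp [binOnes]

theorem binOnes_add_le (x y : ℕ) : binOnes (x + y) ≤ binOnes x + binOnes y := by
  induction hs : x + y using Nat.strong_induction_on generalizing x y with
  | _ s ih =>
    subst hs
    obtain ⟨a, rfl | rfl⟩ := Nat.even_or_odd' x <;> obtain ⟨b, rfl | rfl⟩ := Nat.even_or_odd' y
    · rcases Nat.eq_zero_or_pos (a + b) with h | h
      · obtain ⟨rfl, rfl⟩ : a = 0 ∧ b = 0 := by omega
        simp [binOnes_zero]
      · have := ih (a + b) (by omega) a b rfl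
        rwa [← mul_add, binOnes_two_mul, binOnes_two_mul, binOnes_two_mul]
    · have := ih (a + b) (by omega) a b rfl
      rw [show 2 * a + (2 * b + 1) = 2 * (a + b) + 1 by ring, binOnes_two_mul_add_one,
        binOnes_two_mul_add_one, binOnes_two_mul]
      omega
    · have := ih (a + b) (by omega) a b rfl
      rw [show 2 * a + 1 + 2 * b = 2 * (a + b) + 1 by ring, binOnes_two_mul_add_one,
        binOnes_two_mul_add_one, binOnes_two_mul]
      omega
    · have h1 := ih (a + b + 1) (by omega) (a + b) 1 rfl
      have h2 := ih (a + b) (by omega) a b rfl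
      rw [binOnes_one] at h1
      rw [show 2 * a + 1 + (2 * b + 1) = 2 * (a + b + 1) by ring, binOnes_two_mul,
        binOnes_two_mul_add_one, binOnes_two_mul_add_one]
      omega

theorem binOnes_block (j c r : ℕ) (h : r < 2 ^ j) :
    binOnes (2 ^ j * c + r) = binOnes c + binOnes r := by
  induction j generalizing r with
  | zero => obtain rfl : r = 0 := by omega
            simp [binOnes_zero]
  | succ j ih =>
    rw [pow_succ] at h
    obtain ⟨s, rfl | rfl⟩ := Nat.even_or_odd' r
    · rw [show 2 ^ (j + 1) * c + 2 * s = 2 * (2 ^ j * c + s) by ring, binOnes_two_mul,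
        binOnes_two_mul, ih s (by omega)]
    · rw [show 2 ^ (j + 1) * c + (2 * s + 1) = 2 * (2 ^ j * c + s) + 1 by ring,
        binOnes_two_mul_add_one, binOnes_two_mul_add_one, ih s (by omega), add_assoc]

/-- The subtraction `2 ^ k - 1 - x` complements all `k` binary digits of `x`. -/
theorem binOnes_compl (k x : ℕ) (h : x < 2 ^ k) : binOnes (2 ^ k - 1 - x) + binOnes x = k := by
  induction k generalizing x with
  | zero => obtain rfl : x = 0 := by omega
            simp [binOnes_zero]
  | succ k ih =>
    rw [pow_succ] at h ⊢
    obtain ⟨s, rfl | rfl⟩ := Nat.even_or_odd' x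
    · have := ih s (by omega)
      rw [show 2 ^ k * 2 - 1 - 2 * s = 2 * (2 ^ k - 1 - s) + 1 by omega,
        binOnes_two_mul_add_one, binOnes_two_mul]
      omega
    · have := ih s (by omega)
      rw [show 2 ^ k * 2 - 1 - (2 * s + 1) = 2 * (2 ^ k - 1 - s) by omega,
        binOnes_two_mul_add_one, binOnes_two_mul]
      omega

theorem sigmaOnes_natCast_succ (k : ℕ) :
    sigmaOnes ((k : ℤ) + 1) = sigmaOnes k + binOnes (k + 1) := by
  have h : ((k : ℤ) + 1).toNat = k + 1 := by omega
  rw [sigmaOnes, sigmaOnes, h, Int.toNat_natCast, Finset.sum_Icc_succ_top (by omega)]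

theorem sigmaOnes_of_nonpos {k : ℤ} (h : k ≤ 0) : sigmaOnes k = 0 := by
  simp [sigmaOnes, Int.toNat_of_nonpos h]

/-- The sum of the row bounds `τ₂(m + i)` and the column bounds `τ₂(i)` on the exponents in the
Hankel determinant is its asserted degree. -/
theorem sum_binOnes (m l : ℕ) :
    ((∑ i ∈ Finset.range (l + 1), (binOnes (m + i) + binOnes i) : ℕ) : ℤ) =
      sigmaOnes l + sigmaOnes ((m : ℤ) + l) - sigmaOnes ((m : ℤ) - 1) := by
  induction l with
  | zero =>
    rcases m with - | m
    · simp [sigmaOnes_of_nonpos, binOnes_zero]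
    · have := sigmaOnes_natCast_succ m
      simp only [zero_add, Finset.sum_range_one, Nat.cast_zero, add_zero, binOnes_zero]
      push_cast
      rw [sigmaOnes_of_nonpos le_rfl, this, add_sub_cancel_right]
      push_cast
      ring
  | succ l ih =>
    rw [Finset.sum_range_succ, Nat.cast_add, ih]
    have h1 := sigmaOnes_natCast_succ l
    have h2 := sigmaOnes_natCast_succ (m + l)
    push_cast at h2 ⊢
    rw [← add_assoc (m : ℤ), h1, h2, ← add_assoc m l 1]
    push_cast
    ring

/-! ### The coefficients of `g_u` -/

theorem coeff_prodSeries_eq {R : Type*} [CommRing R] (u : R) (m : ℕ) :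
    PowerSeries.coeff m (prodSeries u) = u ^ binOnes m := by
  induction m using Nat.strong_induction_on with
  | _ m ih =>
    have hf := congrArg (PowerSeries.coeff m) (prodSeries_functional u)
    rw [add_mul, one_mul, map_add, mul_assoc, PowerSeries.coeff_C_mul] at hf
    rw [hf]
    obtain ⟨s, rfl | rfl⟩ := Nat.even_or_odd' m
    · rcases Nat.eq_zero_or_pos s with rfl | hs
      · rw [← hf]
        simp [prodSeries, binOnes_zero, PowerSeries.coeff_mk,
          -PowerSeries.coeff_zero_eq_constantCoeff]
      · have hX : PowerSeries.coeff (2 * s)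
            (PowerSeries.X * PowerSeries.expand 2 two_ne_zero (prodSeries u)) = 0 := by
          obtain ⟨r, rfl⟩ : ∃ r, s = r + 1 := ⟨s - 1, by omega⟩
          rw [show 2 * (r + 1) = (2 * r + 1) + 1 by ring, PowerSeries.coeff_succ_X_mul,
            PowerSeries.coeff_expand_of_not_dvd _ _ _ (by omega)]
        rw [hX, mul_zero, add_zero, PowerSeries.coeff_expand_mul, ih s (by omega),
          binOnes_two_mul]
    · rw [PowerSeries.coeff_succ_X_mul, PowerSeries.coeff_expand_of_not_dvd _ _ _ (by omega),
        zero_add, PowerSeries.coeff_expand_mul, ih s (by omega), binOnes_two_mul_add_one, pow_succ']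

theorem coeff_gTM {R : Type*} [CommRing R] (u : R) (m : ℕ) :
    (gTM u).coeff ((m : ℤ) + 1) = u ^ binOnes m := by
  have h := HahnSeries.coeff_single_mul_add (r := (1 : R))
    (x := HahnSeries.ofPowerSeries ℤ R (prodSeries u)) (a := (m : ℤ)) (b := 1)
  rw [gTM, h, one_mul, PowerSeries.coeff_coe, if_neg (by omega), Int.natAbs_natCast,
    coeff_prodSeries_eq]

/-! ### The leading coefficient of the Hankel determinants -/

open Classical in
/-- The indicator of `x + y` being computed without carries in base two, that is of `x` and `y`
having disjoint binary digits. -/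
noncomputable def noCarry (R : Type*) [CommRing R] (x y : ℕ) : R :=
  if binOnes (x + y) = binOnes x + binOnes y then 1 else 0

section
variable (R : Type*) [CommRing R] (x y : ℕ)

theorem noCarry_zero_right : noCarry R x 0 = 1 := by
  simp [noCarry, binOnes_zero]

theorem noCarry_even_even : noCarry R (2 * x) (2 * y) = noCarry R x y := by
  simp only [noCarry, ← mul_add, binOnes_two_mul]

theorem noCarry_even_odd : noCarry R (2 * x) (2 * y + 1) = noCarry R x y := by
  simp only [noCarry, ← add_assoc, ← mul_add, binOnes_two_mul, binOnes_two_mul_add_one,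
    add_left_inj]

theorem noCarry_odd_even : noCarry R (2 * x + 1) (2 * y) = noCarry R x y := by
  rw [noCarry, noCarry, show 2 * x + 1 + 2 * y = 2 * (x + y) + 1 by ring, binOnes_two_mul,
    binOnes_two_mul_add_one, binOnes_two_mul_add_one, add_right_comm (binOnes x)]
  simp only [add_left_inj]

theorem noCarry_odd_odd : noCarry R (2 * x + 1) (2 * y + 1) = 0 := by
  have h1 := binOnes_add_le (x + y) 1
  have h2 := binOnes_add_le x y
  rw [binOnes_one] at h1
  rw [noCarry, if_neg]
  rw [show 2 * x + 1 + (2 * y + 1) = 2 * (x + y + 1) by ring, binOnes_two_mul,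
    binOnes_two_mul_add_one, binOnes_two_mul_add_one]
  omega

end

theorem sum_range_two_mul {M : Type*} [AddCommMonoid M] (f : ℕ → M) (r : ℕ) :
    ∑ j ∈ Finset.range (2 * r), f j =
      ∑ j ∈ Finset.range r, f (2 * j) + ∑ j ∈ Finset.range r, f (2 * j + 1) := by
  induction r with
  | zero => simp
  | succ r ih =>
    rw [mul_add, mul_one, Finset.sum_range_succ, Finset.sum_range_succ, ih,
      Finset.sum_range_succ, Finset.sum_range_succ]
    abel

/-- An interval of `N` consecutive rows of the carry-free matrix, cut to its first `N` columns, has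
trivial kernel. Separating rows and columns by parity reduces `N` to about `N / 2`: an odd row only
sees the entries `v (2 j)`, an even row sees the sums `v (2 j) + v (2 j + 1)`. -/
theorem eq_zero_of_noCarry_kernel {R : Type*} [CommRing R] (N m : ℕ) (v : ℕ → R)
    (h : ∀ x, m ≤ x → x < m + N → ∑ j ∈ Finset.range N, noCarry R x j * v j = 0) :
    ∀ j < N, v j = 0 := by
  induction N using Nat.strong_induction_on generalizing m v with
  | _ N ih =>
    obtain ⟨r, rfl | rfl⟩ := Nat.even_or_odd' N
    · rcases Nat.eq_zero_or_pos r with rfl | hr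
      · omega
      have hev : ∀ j < r, v (2 * j) = 0 := by
        refine ih r (by omega) (m / 2) (fun j => v (2 * j)) fun x h1 h2 => ?_
        have := h (2 * x + 1) (by omega) (by omega)
        simpa [sum_range_two_mul, noCarry_odd_even, noCarry_odd_odd] using this
      have hod : ∀ j < r, v (2 * j + 1) = 0 := by
        refine ih r (by omega) ((m + 1) / 2) (fun j => v (2 * j + 1)) fun x h1 h2 => ?_
        have := h (2 * x) (by omega) (by omega)
        rw [sum_range_two_mul, Finset.sum_eq_zero (s := Finset.range r)
          (fun j hj => by rw [hev j (Finset.mem_range.1 hj), mul_zero]), zero_add] at this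
        simpa [noCarry_even_odd] using this
      intro j hj
      obtain ⟨s, rfl | rfl⟩ := Nat.even_or_odd' j
      · exact hev s (by omega)
      · exact hod s (by omega)
    · rcases Nat.eq_zero_or_pos r with rfl | hr
      · have := h m le_rfl (by omega)
        intro j hj
        obtain rfl : j = 0 := by omega
        simpa [noCarry_zero_right] using this
      obtain ⟨a, rfl | rfl⟩ := Nat.even_or_odd' m
      · -- `r + 1` even rows and `r` odd rows
        have hsum : ∀ j < r + 1, v (2 * j) + (if j < r then v (2 * j + 1) else 0) = 0 := by
          refine ih (r + 1) (by omega) a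
            (fun j => v (2 * j) + (if j < r then v (2 * j + 1) else 0)) fun x h1 h2 => ?_
          have := h (2 * x) (by omega) (by omega)
          rw [Finset.sum_range_succ, sum_range_two_mul, noCarry_even_even,
            ← Finset.sum_add_distrib] at this
          rw [Finset.sum_range_succ, if_neg (lt_irrefl r), add_zero, ← this]
          congr 1
          refine Finset.sum_congr rfl fun j hj => ?_
          rw [if_pos (Finset.mem_range.1 hj), noCarry_even_even, noCarry_even_odd, mul_add]
        have hlast : v (2 * r) = 0 := by simpa using hsum r (by omega)
        have hev : ∀ j < r, v (2 * j) = 0 := by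
          refine ih r (by omega) a (fun j => v (2 * j)) fun x h1 h2 => ?_
          have := h (2 * x + 1) (by omega) (by omega)
          rw [Finset.sum_range_succ, hlast, mul_zero, add_zero] at this
          simpa [sum_range_two_mul, noCarry_odd_even, noCarry_odd_odd] using this
        intro j hj
        obtain ⟨s, rfl | rfl⟩ := Nat.even_or_odd' j
        · rcases Nat.lt_or_ge s r with hs | hs
          · exact hev s hs
          · obtain rfl : s = r := by omega
            exact hlast
        · have := hsum s (by omega)
          rwa [if_pos (by omega), hev s (by omega), zero_add] at this
      · -- `r + 1` odd rows and `r` even rows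
        have hev : ∀ j < r + 1, v (2 * j) = 0 := by
          refine ih (r + 1) (by omega) a (fun j => v (2 * j)) fun x h1 h2 => ?_
          have := h (2 * x + 1) (by omega) (by omega)
          rw [Finset.sum_range_succ] at this
          rw [Finset.sum_range_succ]
          simpa [sum_range_two_mul, noCarry_odd_even, noCarry_odd_odd] using this
        have hod : ∀ j < r, v (2 * j + 1) = 0 := by
          refine ih r (by omega) (a + 1) (fun j => v (2 * j + 1)) fun x h1 h2 => ?_
          have := h (2 * x) (by omega) (by omega)
          rw [Finset.sum_range_succ, hev r (by omega), mul_zero, add_zero,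
            sum_range_two_mul, Finset.sum_eq_zero (s := Finset.range r)
            (fun j hj => by
              rw [hev j (by have := Finset.mem_range.1 hj; omega), mul_zero]), zero_add] at this
          simpa [noCarry_even_odd] using this
        intro j hj
        obtain ⟨s, rfl | rfl⟩ := Nat.even_or_odd' j
        · exact hev s (by omega)
        · exact hod s (by omega)

/-- The square carry-free matrix with rows `m, …, m + N - 1` and columns `0, …, N - 1`. -/
noncomputable def noCarryMatrix (R : Type*) [CommRing R] (m N : ℕ) : Matrix (Fin N) (Fin N) R :=
  Matrix.of fun i j => noCarry R (m + i) j

theorem det_noCarryMatrix_ne_zero {K : Type*} [Field K] (m N : ℕ) :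
    (noCarryMatrix K m N).det ≠ 0 := by
  intro h0
  obtain ⟨v, hv, hM⟩ := Matrix.exists_mulVec_eq_zero_iff.2 h0
  apply hv
  have key := eq_zero_of_noCarry_kernel N m (fun j => if h : j < N then v ⟨j, h⟩ else 0) ?_
  · ext j
    simpa using key j j.2
  · intro x h1 h2
    have := congrFun hM ⟨x - m, by omega⟩
    rw [Matrix.mulVec, dotProduct] at this
    rw [Finset.sum_range]
    simpa [noCarryMatrix, show m + (x - m) = x by omega] using this

theorem det_noCarryMatrix_int (m N : ℕ) :
    (noCarryMatrix ℤ m N).det = 1 ∨ (noCarryMatrix ℤ m N).det = -1 := by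
  rw [← Int.isUnit_iff, Int.isUnit_iff_natAbs_eq]
  by_contra h
  obtain ⟨p, hp, hd⟩ := Nat.exists_prime_and_dvd h
  have := Fact.mk hp
  apply det_noCarryMatrix_ne_zero (K := ZMod p) m N
  have hmap : noCarryMatrix (ZMod p) m N =
      (Int.castRingHom (ZMod p)).mapMatrix (noCarryMatrix ℤ m N) := by
    ext i j
    simp [noCarryMatrix, noCarry]
  rw [hmap, ← RingHom.map_det]
  exact (ZMod.intCast_zmod_eq_zero_iff_dvd _ _).2 (Int.natCast_dvd.2 hd)

/-! ### Hankel determinants as polynomials in `u` -/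

/-- The matrix `(X ^ τ₂(m + i + j))` of size `N`, which specialises at `X = u` to the Hankel matrix
of `g_u` with offset `m + 1`. -/
noncomputable def genHankel (m N : ℕ) : Matrix (Fin N) (Fin N) ℤ[X] :=
  Matrix.of fun i j => X ^ binOnes (m + i + j)

theorem hankel_gTM (u : ℚ) (m l : ℕ) :
    hankel (gTM u) ((m : ℤ) + 1) l = (aeval u).toRingHom.mapMatrix (genHankel m (l + 1)) := by
  ext i j
  have h := coeff_gTM u (m + i + j)
  push_cast at h
  rw [hankel, Matrix.of_apply,
    show (m : ℤ) + 1 + (i : ℕ) + (j : ℕ) = (m : ℤ) + (i : ℕ) + (j : ℕ) + 1 by ring, h]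
  simp [genHankel]

theorem coeff_det_X_pow {N : ℕ} (e : Fin N → Fin N → ℕ) (d : ℕ) :
    (Matrix.det (Matrix.of fun i j => (X : ℤ[X]) ^ e i j)).coeff d =
      ∑ s : Equiv.Perm (Fin N), (Equiv.Perm.sign s : ℤ) *
        if d = ∑ i, e (s i) i then 1 else 0 := by
  rw [Matrix.det_apply', finsetSum_coeff]
  refine Finset.sum_congr rfl fun s _ => ?_
  simp only [Matrix.of_apply]
  rw [Finset.prod_pow_eq_pow_sum, ← Polynomial.C_eq_intCast, coeff_C_mul, coeff_X_pow]
  simp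

/-- The sum of the bounds on the exponents of `genHankel m N`. -/
def hankelDegree (m N : ℕ) : ℕ := ∑ i ∈ Finset.range N, (binOnes (m + i) + binOnes i)

theorem sum_row_col_bounds (m N : ℕ) (s : Equiv.Perm (Fin N)) :
    ∑ i : Fin N, (binOnes (m + s i) + binOnes i) = hankelDegree m N := by
  rw [hankelDegree, Finset.sum_range, Finset.sum_add_distrib, Finset.sum_add_distrib]
  congr 1
  exact Equiv.sum_comp s fun i : Fin N => binOnes (m + i)

theorem coeff_det_genHankel_of_lt {m N d : ℕ} (h : hankelDegree m N < d) :
    (genHankel m N).det.coeff d = 0 := by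
  rw [genHankel, coeff_det_X_pow]
  refine Finset.sum_eq_zero fun s _ => ?_
  rw [if_neg, mul_zero]
  have h1 : ∑ i : Fin N, binOnes (m + s i + i) ≤ hankelDegree m N := by
    rw [← sum_row_col_bounds m N s]
    exact Finset.sum_le_sum fun i _ => binOnes_add_le _ _
  omega

/-- Since each exponent obeys `τ₂(m + i + j) ≤ τ₂(m + i) + τ₂(j)`, a permutation contributes to the
top coefficient exactly when all of these bounds are attained along it. -/
theorem coeff_det_genHankel (m N : ℕ) :
    (genHankel m N).det.coeff (hankelDegree m N) = (noCarryMatrix ℤ m N).det := by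
  rw [genHankel, coeff_det_X_pow, Matrix.det_apply']
  refine Finset.sum_congr rfl fun s _ => ?_
  congr 1
  simp only [noCarryMatrix, Matrix.of_apply, noCarry]
  rw [Fintype.prod_boole]
  have h1 : (∑ i : Fin N, binOnes (m + s i + i) = ∑ i : Fin N, (binOnes (m + s i) + binOnes i)) ↔
      ∀ i ∈ Finset.univ, binOnes (m + s i + i) = binOnes (m + s i) + binOnes (i : ℕ) :=
    Finset.sum_eq_sum_iff_of_le fun i _ => binOnes_add_le _ _
  rw [sum_row_col_bounds] at h1
  simp only [Finset.mem_univ, true_implies] at h1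
  simp only [← h1, eq_comm (a := hankelDegree m N)]

theorem natDegree_det_genHankel (m N : ℕ) : (genHankel m N).det.natDegree = hankelDegree m N := by
  apply natDegree_eq_of_le_of_coeff_ne_zero
  · exact natDegree_le_iff_coeff_eq_zero.2 fun d hd => coeff_det_genHankel_of_lt hd
  · rw [coeff_det_genHankel]
    rcases det_noCarryMatrix_int m N with h | h <;> simp [h]

theorem leadingCoeff_det_genHankel (m N : ℕ) :
    (genHankel m N).det.leadingCoeff = 1 ∨ (genHankel m N).det.leadingCoeff = -1 := by
  rw [leadingCoeff, natDegree_det_genHankel, coeff_det_genHankel]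
  exact det_noCarryMatrix_int m N

/-! ### The lowest coefficient and rational roots -/

/-- Complementing binary digits and reversing rows and columns turns `τ₂` into `k - τ₂`, so the
reflection of one Hankel determinant is another one. -/
theorem reflect_det_genHankel {m l k : ℕ} (h : m + 2 * l < 2 ^ k) :
    reflect ((l + 1) * k) (genHankel m (l + 1)).det =
      (genHankel (2 ^ k - 1 - m - 2 * l) (l + 1)).det := by
  rw [← Matrix.det_submatrix_equiv_self Fin.revPerm (genHankel (2 ^ k - 1 - m - 2 * l) (l + 1))]
  have hsub : (genHankel (2 ^ k - 1 - m - 2 * l) (l + 1)).submatrix Fin.revPerm Fin.revPerm =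
      Matrix.of fun i j : Fin (l + 1) => (X : ℤ[X]) ^ (k - binOnes (m + i + j)) := by
    ext1 i j
    have hi := i.2
    have hj := j.2
    have hc := binOnes_compl k (m + i + j) (by omega)
    simp only [genHankel, Matrix.submatrix_apply, Matrix.of_apply, Fin.revPerm_apply, Fin.val_rev]
    rw [show 2 ^ k - 1 - m - 2 * l + (l + 1 - (i + 1)) + (l + 1 - (j + 1)) =
      2 ^ k - 1 - (m + i + j) by omega]
    congr 1
    omega
  rw [hsub]
  ext d
  have hle : ∀ (s : Equiv.Perm (Fin (l + 1))) (i : Fin (l + 1)), binOnes (m + s i + i) ≤ k := by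
    intro s i
    have hi := i.2
    have hj := (s i).2
    have hc := binOnes_compl k (m + s i + i) (by omega)
    omega
  have hsum : ∀ s : Equiv.Perm (Fin (l + 1)),
      ∑ i, (k - binOnes (m + s i + i)) + ∑ i : Fin (l + 1), binOnes (m + s i + i) =
        (l + 1) * k := by
    intro s
    rw [← Finset.sum_add_distrib, Finset.sum_congr rfl fun i _ => Nat.sub_add_cancel (hle s i)]
    simp
  rw [coeff_reflect, genHankel, coeff_det_X_pow, coeff_det_X_pow]
  refine Finset.sum_congr rfl fun s _ => ?_
  congr 1
  refine if_congr ?_ rfl rfl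
  have := hsum s
  rcases le_or_gt d ((l + 1) * k) with hd | hd
  · rw [revAt_le hd]
    omega
  · rw [revAt_eq_self_of_lt hd]
    omega

theorem trailingCoeff_reflect {f : ℤ[X]} {N : ℕ} (h : f.natDegree ≤ N) :
    (reflect N f).trailingCoeff = f.leadingCoeff := by
  have h1 : reflect N f = f.reverse * X ^ (N - f.natDegree) := by
    have := reflect_mul f 1 (le_refl f.natDegree) (G := N - f.natDegree) (by simp)
    rwa [mul_one, reflect_one, Nat.add_sub_cancel' h] at this
  rw [h1, trailingCoeff_mul, reverse_trailingCoeff]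
  simp [trailingCoeff]

theorem doublyMonic_det_genHankel (m l : ℕ) : DoublyMonic (genHankel m (l + 1)).det := by
  refine ⟨leadingCoeff_det_genHankel m (l + 1), ?_⟩
  have hk : m + 2 * l < 2 ^ (m + 2 * l) := Nat.lt_two_pow_self
  have hr := reflect_det_genHankel hk
  have hr' : (genHankel m (l + 1)).det = reflect ((l + 1) * (m + 2 * l))
      (genHankel (2 ^ (m + 2 * l) - 1 - m - 2 * l) (l + 1)).det := by
    rw [← hr, reflect_reflect]
  have hd : (genHankel (2 ^ (m + 2 * l) - 1 - m - 2 * l) (l + 1)).det.natDegree ≤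
      (l + 1) * (m + 2 * l) := by
    rw [natDegree_le_iff_coeff_eq_zero]
    intro d hd
    rw [genHankel, coeff_det_X_pow]
    refine Finset.sum_eq_zero fun s _ => ?_
    rw [if_neg, mul_zero]
    have h1 : ∑ i : Fin (l + 1), binOnes (2 ^ (m + 2 * l) - 1 - m - 2 * l + s i + i) ≤
        ∑ i : Fin (l + 1), (m + 2 * l) := by
      refine Finset.sum_le_sum fun i _ => ?_
      have hi := i.2
      have hj := (s i).2
      have := binOnes_compl (m + 2 * l) (2 ^ (m + 2 * l) - 1 - m - 2 * l + s i + i) (by omega)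
      omega
    simp only [Finset.sum_const, Finset.card_univ, Fintype.card_fin, smul_eq_mul] at h1
    omega
  rw [hr', trailingCoeff_reflect hd]
  exact leadingCoeff_det_genHankel _ _

theorem exists_int_of_aeval_eq_zero {D : ℤ[X]} (hD : D.leadingCoeff = 1 ∨ D.leadingCoeff = -1)
    {u : ℚ} (h : aeval u D = 0) : ∃ z : ℤ, (z : ℚ) = u := by
  have hd := den_dvd_of_is_root h
  have hu : IsUnit D.leadingCoeff := Int.isUnit_iff.2 hD
  obtain ⟨z, hz⟩ := IsFractionRing.isInteger_of_isUnit_den (isUnit_of_dvd_unit hd hu)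
  exact ⟨z, by simpa using hz⟩

/-- The rational roots of a doubly monic polynomial lie in `{0, 1, -1}`. -/
theorem DoublyMonic.aeval_ne_zero {D : ℤ[X]} (hD : DoublyMonic D) {u : ℚ} (h0 : u ≠ 0)
    (h1 : u ≠ 1) (h2 : u ≠ -1) : aeval u D ≠ 0 := by
  intro h
  obtain ⟨z, hz⟩ := exists_int_of_aeval_eq_zero hD.1 h
  have := invertibleOfNonzero h0
  have hrev : aeval u⁻¹ D.reverse = 0 := by
    rw [← invOf_eq_inv]
    exact (eval₂_reverse_eq_zero_iff (algebraMap ℤ ℚ) u D).2 h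
  obtain ⟨w, hw⟩ := exists_int_of_aeval_eq_zero
    (by rw [reverse_leadingCoeff]; exact hD.2) hrev
  have hzw : z * w = 1 := by
    have : (z : ℚ) * w = 1 := by rw [hz, hw, mul_inv_cancel₀ h0]
    exact_mod_cast this
  rcases Int.isUnit_iff.1 (IsUnit.of_mul_eq_one w hzw) with rfl | rfl
  · exact h1 (by simpa using hz.symm)
  · exact h2 (by simpa using hz.symm)

/-! ### Coefficients and absolute values in `F((t⁻¹))` -/

section
variable {R : Type*} [CommRing R]

theorem ofPoly_add (p q : R[X]) : ofPoly (p + q) = ofPoly p + ofPoly q := map_add _ _ _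

theorem ofPoly_mul (p q : R[X]) : ofPoly (p * q) = ofPoly p * ofPoly q := map_mul _ _ _

theorem tVar_pow (k : ℕ) : tVar R ^ k = HahnSeries.single (-(k : ℤ)) 1 := by
  rw [tVar, HahnSeries.single_pow]
  simp

theorem coeff_tVar_pow_mul (k : ℕ) (β : LaurentSeries R) (i : ℤ) :
    (tVar R ^ k * β).coeff i = β.coeff (i + k) := by
  have h := HahnSeries.coeff_single_mul_add (r := (1 : R)) (x := β) (a := i + k) (b := -(k : ℤ))
  rw [add_neg_cancel_right, one_mul] at h
  rw [tVar_pow, h]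

theorem algebraMap_laurentSeries (r : R) :
    algebraMap R (LaurentSeries R) r = HahnSeries.C r := by
  simp [HahnSeries.algebraMap_apply']

theorem coeff_ofPoly_mul {q : R[X]} {N : ℕ} (h : q.natDegree < N) (β : LaurentSeries R) (i : ℤ) :
    (ofPoly q * β).coeff i = ∑ j ∈ Finset.range N, q.coeff j * β.coeff (i + j) := by
  rw [ofPoly, aeval_eq_sum_range' h, Finset.sum_mul, HahnSeries.coeff_sum]
  refine Finset.sum_congr rfl fun j _ => ?_
  rw [Algebra.smul_def, algebraMap_laurentSeries, mul_assoc, HahnSeries.C_mul_eq_smul,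
    HahnSeries.coeff_smul, coeff_tVar_pow_mul, smul_eq_mul]

theorem coeff_ofPoly_neg (q : R[X]) (n : ℕ) : (ofPoly q).coeff (-(n : ℤ)) = q.coeff n := by
  rw [← mul_one (ofPoly q), coeff_ofPoly_mul (Nat.lt_succ_self _)]
  simp only [HahnSeries.coeff_one]
  rw [Finset.sum_eq_single n]
  · simp
  · intro j _ hj
    rw [if_neg (by omega), mul_zero]
  · intro hn
    rw [coeff_eq_zero_of_natDegree_lt (by simpa using hn), zero_mul]

theorem coeff_ofPoly_of_pos (q : R[X]) {i : ℤ} (h : 0 < i) : (ofPoly q).coeff i = 0 := by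
  rw [← mul_one (ofPoly q), coeff_ofPoly_mul (Nat.lt_succ_self _)]
  refine Finset.sum_eq_zero fun j _ => ?_
  rw [HahnSeries.coeff_one, if_neg (by omega), mul_zero]

/-- Every Laurent series has a polynomial part. -/
theorem exists_polyPart (β : LaurentSeries R) :
    ∃ p : R[X], ∀ i : ℤ, i ≤ 0 → (β - ofPoly p).coeff i = 0 := by
  refine ⟨∑ j ∈ Finset.range ((-β.order).toNat + 1), monomial j (β.coeff (-(j : ℤ))),
    fun i hi => ?_⟩
  obtain ⟨n, rfl⟩ : ∃ n : ℕ, i = -(n : ℤ) := ⟨(-i).toNat, by omega⟩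
  rw [HahnSeries.coeff_sub, coeff_ofPoly_neg, finsetSum_coeff]
  simp only [coeff_monomial]
  rw [Finset.sum_ite_eq']
  split_ifs with h
  · exact sub_self _
  · rw [sub_zero]
    rw [Finset.mem_range] at h
    exact HahnSeries.coeff_eq_zero_of_lt_order (by omega)

theorem absVal_nonneg (β : LaurentSeries R) : 0 ≤ absVal β := by
  rw [absVal]
  split_ifs <;> positivity

theorem le_absVal {β : LaurentSeries R} {k : ℤ} (h : β.coeff k ≠ 0) :
    (2 : ℝ) ^ (-k) ≤ absVal β := by
  rw [absVal, if_neg (by rintro rfl; simp at h)]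
  exact zpow_le_zpow_right₀ one_le_two (neg_le_neg (HahnSeries.order_le_of_coeff_ne_zero h))

theorem absVal_le {β : LaurentSeries R} {k : ℤ} (h : ∀ i < k, β.coeff i = 0) :
    absVal β ≤ (2 : ℝ) ^ (-k) := by
  rw [absVal]
  split_ifs with h0
  · positivity
  · refine zpow_le_zpow_right₀ one_le_two (neg_le_neg ?_)
    by_contra hlt
    exact h0 (HahnSeries.coeff_order_eq_zero.1 (h _ (not_le.1 hlt)))

theorem absVal_ofPoly {q : R[X]} (hq : q ≠ 0) : absVal (ofPoly q) = (2 : ℝ) ^ q.natDegree := by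
  apply le_antisymm
  · have := absVal_le (β := ofPoly q) (k := -(q.natDegree : ℤ)) fun i hi => by
      obtain ⟨n, rfl⟩ : ∃ n : ℕ, i = -(n : ℤ) := ⟨(-i).toNat, by omega⟩
      rw [coeff_ofPoly_neg]
      exact coeff_eq_zero_of_natDegree_lt (by omega)
    simpa using this
  · have := le_absVal (β := ofPoly q) (k := -(q.natDegree : ℤ)) (by
      rw [coeff_ofPoly_neg]
      exact leadingCoeff_ne_zero.2 hq)
    simpa using this

theorem distPoly_nonneg (β : LaurentSeries R) : 0 ≤ distPoly β :=
  Real.iInf_nonneg fun _ => absVal_nonneg _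

theorem distPoly_le {β : LaurentSeries R} {k : ℕ} (h : ∀ i : ℕ, i < k → β.coeff ((i : ℤ) + 1) = 0) :
    distPoly β ≤ (2 : ℝ) ^ (-((k : ℤ) + 1)) := by
  obtain ⟨p, hp⟩ := exists_polyPart β
  refine (ciInf_le ⟨0, ?_⟩ p).trans (absVal_le fun i hi => ?_)
  · rintro _ ⟨p, rfl⟩
    exact absVal_nonneg _
  · rcases le_or_gt i 0 with h0 | h0
    · exact hp i h0
    · obtain ⟨n, rfl⟩ : ∃ n : ℕ, i = n + 1 := ⟨(i - 1).toNat, by omega⟩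
      rw [HahnSeries.coeff_sub, coeff_ofPoly_of_pos p h0, sub_zero, h n (by omega)]

theorem le_distPoly {β : LaurentSeries R} {k i : ℕ} (hi : i ≤ k) (h : β.coeff ((i : ℤ) + 1) ≠ 0) :
    (2 : ℝ) ^ (-((k : ℤ) + 1)) ≤ distPoly β := by
  refine le_ciInf fun p => le_trans ?_ (le_absVal (k := (i : ℤ) + 1) ?_)
  · exact zpow_le_zpow_right₀ one_le_two (by omega)
  · rwa [HahnSeries.coeff_sub, coeff_ofPoly_of_pos p (by omega), sub_zero]

/-- It suffices that one of the coefficients of `t⁻¹, …, t ^ (-deg q - 1)` of `β` is non-zero. -/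
theorem half_le_absVal_mul_distPoly {q : R[X]} (hq : q ≠ 0) {β : LaurentSeries R}
    (h : ∃ i ≤ q.natDegree, β.coeff ((i : ℤ) + 1) ≠ 0) :
    1 / 2 ≤ absVal (ofPoly q) * distPoly β := by
  obtain ⟨i, hi, hβ⟩ := h
  rw [absVal_ofPoly hq]
  calc (1 / 2 : ℝ) = 2 ^ q.natDegree * 2 ^ (-((q.natDegree : ℤ) + 1)) := by
        rw [← zpow_natCast, ← zpow_add₀ two_ne_zero]
        simp
    _ ≤ _ := by
        gcongr
        exact le_distPoly hi hβ

end

/-! ### Non-vanishing Hankel determinants -/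

theorem det_hankel_gTM (u : ℚ) (m l : ℕ) :
    (hankel (gTM u) ((m : ℤ) + 1) l).det = aeval u (genHankel m (l + 1)).det := by
  rw [AlgHom.map_det, hankel_gTM]
  rfl

/-- If the coefficients of `t⁻¹, …, t ^ (-deg q - 1)` of `q t ^ k α` all vanished, then the
coefficient vector of `q` would lie in the kernel of a Hankel matrix of `α`. -/
theorem exists_coeff_ne_zero_of_hankel {F : Type*} [Field F] (α : LaurentSeries F) {q : F[X]}
    (hq : q ≠ 0) (k : ℕ) (h : (hankel α ((k : ℤ) + 1) q.natDegree).det ≠ 0) :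
    ∃ i ≤ q.natDegree, (ofPoly q * tVar F ^ k * α).coeff ((i : ℤ) + 1) ≠ 0 := by
  by_contra! hc
  apply h
  refine Matrix.exists_mulVec_eq_zero_iff.1 ⟨fun j => q.coeff j, fun h0 => hq ?_, ?_⟩
  · have := congrFun h0 (Fin.last _)
    simpa using this
  · ext i
    have := hc i (by omega)
    rw [mul_assoc, coeff_ofPoly_mul (Nat.lt_succ_self _), Finset.sum_range] at this
    rw [Pi.zero_apply, ← this, Matrix.mulVec, dotProduct]
    refine Finset.sum_congr rfl fun j _ => ?_
    rw [mul_comm, hankel, Matrix.of_apply, coeff_tVar_pow_mul]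
    congr 2
    ring

theorem gTM_mem_ELCδ {u : ℚ} (h0 : u ≠ 0) (h1 : u ≠ 1) (h2 : u ≠ -1) :
    gTM u ∈ ELCδ ℚ (1 / 2) := by
  have key : 1 / 2 ≤ littlewoodInf (gTM u) := by
    have : Nonempty ({q : ℚ[X] // q ≠ 0} × ℕ) := ⟨⟨⟨1, one_ne_zero⟩, 0⟩⟩
    refine le_ciInf fun x => half_le_absVal_mul_distPoly x.1.2 ?_
    refine exists_coeff_ne_zero_of_hankel (gTM u) x.1.2 x.2 ?_
    rw [det_hankel_gTM]
    exact (doublyMonic_det_genHankel _ _).aeval_ne_zero h0 h1 h2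
  exact ⟨lt_of_lt_of_le (by norm_num) key, key⟩

/-! ### The Thue–Morse series satisfies `t`-LC -/

/-- The blocks of length `2 ^ j` numbered `2, 3, 4, 5` alternate in sign. -/
theorem thueMorse_antiperiod (j i : ℕ) (hi : i < 3 * 2 ^ j) :
    (-1 : ℚ) ^ binOnes (2 * 2 ^ j + i + 2 ^ j) = -(-1) ^ binOnes (2 * 2 ^ j + i) := by
  have hr : i % 2 ^ j < 2 ^ j := Nat.mod_lt _ (by positivity)
  have hc : i / 2 ^ j < 3 := Nat.div_lt_of_lt_mul (by rwa [mul_comm])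
  have hi' := Nat.div_add_mod i (2 ^ j)
  generalize i % 2 ^ j = r at *
  generalize i / 2 ^ j = c at *
  rw [show 2 * 2 ^ j + i = 2 ^ j * (c + 2) + r by rw [← hi']; ring,
    show 2 ^ j * (c + 2) + r + 2 ^ j = 2 ^ j * (c + 3) + r by ring, binOnes_block _ _ _ hr,
    binOnes_block _ _ _ hr, pow_add, pow_add]
  interval_cases c <;> norm_num [binOnes]

/-- The Thue–Morse word contains `V V̄ V V̄` for blocks `V` of length `h = 2 ^ j`, so the choice
`q = t ^ h + 1` makes `3 h` coefficients vanish. -/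
theorem littlewoodInf_thueMorse_le (j : ℕ) : littlewoodInf (gTM (-1 : ℚ)) ≤ (1 / 2) ^ j := by
  have hh : j < 2 ^ j := Nat.lt_two_pow_self
  have hq0 : (X ^ 2 ^ j + C 1 : ℚ[X]) ≠ 0 := X_pow_add_C_ne_zero (by positivity) 1
  have hbdd : BddBelow (Set.range fun x : {q : ℚ[X] // q ≠ 0} × ℕ =>
      absVal (ofPoly x.1.1) * distPoly (ofPoly x.1.1 * tVar ℚ ^ x.2 * gTM (-1 : ℚ))) := by
    refine ⟨0, ?_⟩
    rintro _ ⟨x, rfl⟩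
    exact mul_nonneg (absVal_nonneg _) (distPoly_nonneg _)
  refine (ciInf_le hbdd ⟨⟨_, hq0⟩, 2 * 2 ^ j⟩).trans ?_
  have hd : distPoly (ofPoly (X ^ 2 ^ j + C 1 : ℚ[X]) * tVar ℚ ^ (2 * 2 ^ j) * gTM (-1 : ℚ)) ≤
      (2 : ℝ) ^ (-(((3 * 2 ^ j : ℕ) : ℤ) + 1)) := by
    refine distPoly_le fun i hi => ?_
    have h1 : ofPoly (X ^ 2 ^ j + C 1 : ℚ[X]) = tVar ℚ ^ 2 ^ j + 1 := by simp [ofPoly]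
    have h2 := coeff_gTM (-1 : ℚ) (2 * 2 ^ j + i + 2 ^ j)
    have h3 := coeff_gTM (-1 : ℚ) (2 * 2 ^ j + i)
    rw [thueMorse_antiperiod j i hi] at h2
    rw [h1, mul_assoc, add_mul, one_mul, HahnSeries.coeff_add, coeff_tVar_pow_mul,
      coeff_tVar_pow_mul, coeff_tVar_pow_mul,
      show (i : ℤ) + 1 + (2 ^ j : ℕ) + (2 * 2 ^ j : ℕ) = ((2 * 2 ^ j + i + 2 ^ j : ℕ) : ℤ) + 1 by
        push_cast; ring,
      show (i : ℤ) + 1 + (2 * 2 ^ j : ℕ) = ((2 * 2 ^ j + i : ℕ) : ℤ) + 1 by push_cast; ring,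
      h2, h3, neg_add_cancel]
  calc absVal (ofPoly (X ^ 2 ^ j + C 1 : ℚ[X])) * _
      ≤ 2 ^ 2 ^ j * (2 : ℝ) ^ (-(((3 * 2 ^ j : ℕ) : ℤ) + 1)) := by
        rw [absVal_ofPoly hq0, natDegree_X_pow_add_C]
        gcongr
    _ = (2 : ℝ) ^ (((2 ^ j : ℕ) : ℤ) + -(((3 * 2 ^ j : ℕ) : ℤ) + 1)) := by
        rw [zpow_add₀ two_ne_zero, zpow_natCast]
    _ ≤ (2 : ℝ) ^ (-(j : ℤ)) := zpow_le_zpow_right₀ one_le_two (by omega)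
    _ = (1 / 2) ^ j := by rw [zpow_neg, zpow_natCast, one_div, inv_pow]

theorem thueMorse_notMem_ELC : gTM (-1 : ℚ) ∉ ELC ℚ := by
  intro h
  obtain ⟨j, hj⟩ := exists_pow_lt_of_lt_one (show 0 < littlewoodInf (gTM (-1 : ℚ)) from h)
    (show (1 / 2 : ℝ) < 1 by norm_num)
  exact absurd (littlewoodInf_thueMorse_le j) (not_le.2 hj)

/-! ### The Thue–Morse series is badly approximable -/

/-- The period-doubling sequence modulo two: the parity of half the difference of consecutive
Thue–Morse signs. -/
def periodDoubling (k : ℕ) : ZMod 2 := (binOnes k + binOnes (k + 1) : ℕ)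

theorem periodDoubling_even (k : ℕ) : periodDoubling (2 * k) = 1 := by
  rw [periodDoubling, binOnes_two_mul_add_one, binOnes_two_mul]
  push_cast
  linear_combination (binOnes k : ZMod 2) * (CharTwo.two_eq_zero : (2 : ZMod 2) = 0)

theorem periodDoubling_odd (k : ℕ) : periodDoubling (2 * k + 1) = periodDoubling k + 1 := by
  rw [periodDoubling, periodDoubling, show 2 * k + 1 + 1 = 2 * (k + 1) by ring,
    binOnes_two_mul_add_one, binOnes_two_mul]
  push_cast
  ring

theorem exists_half_diff (k : ℕ) : ∃ e : ℤ,
    (-1) ^ binOnes k - (-1) ^ binOnes (k + 1) = 2 * e ∧ (e : ZMod 2) = periodDoubling k := by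
  have two : (2 : ZMod 2) = 0 := CharTwo.two_eq_zero
  rw [periodDoubling]
  obtain ⟨a, ha⟩ := Nat.even_or_odd' (binOnes k)
  obtain ⟨b, hb⟩ := Nat.even_or_odd' (binOnes (k + 1))
  rcases ha with ha | ha <;> rcases hb with hb | hb <;> rw [ha, hb]
  · exact ⟨0, by simp, by push_cast; linear_combination (-a - b : ZMod 2) * two⟩
  · exact ⟨1, by simp [pow_succ], by
      push_cast; linear_combination (-a - b : ZMod 2) * two⟩
  · exact ⟨-1, by simp [pow_succ], by
      push_cast; linear_combination (-a - b - 1 : ZMod 2) * two⟩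
  · exact ⟨0, by simp [pow_succ], by
      push_cast; linear_combination (-a - b - 1 : ZMod 2) * two⟩

/-- Squaring over `ZMod 2` is the substitution `X ↦ X ^ 2`. -/
theorem powerSeries_sq_eq_expand (f : PowerSeries (ZMod 2)) :
    f ^ 2 = PowerSeries.expand 2 two_ne_zero f := by
  ext n
  have h : PowerSeries.coeff n (f ^ 2) =
      PowerSeries.coeff n ((PowerSeries.trunc (n + 1) f : PowerSeries (ZMod 2)) ^ 2) := by
    rw [PowerSeries.coeff_pow, PowerSeries.coeff_pow]
    refine Finset.sum_congr rfl fun l hl => Finset.prod_congr rfl fun i hi => ?_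
    rw [Polynomial.coeff_coe, PowerSeries.coeff_trunc, if_pos]
    have h1 : ∑ x ∈ Finset.range 2, l x = n := (Finset.mem_finsuppAntidiag.1 hl).1
    have := Finset.single_le_sum (f := l) (fun _ _ => Nat.zero_le _) hi
    omega
  rw [h, ← Polynomial.coe_pow, Polynomial.coeff_coe, ← ZMod.expand_card,
    Polynomial.coeff_expand two_pos, PowerSeries.coeff_expand, PowerSeries.coeff_trunc]
  split_ifs with h1 h2
  · rfl
  · omega
  · rfl

theorem mk_periodDoubling :
    (1 - PowerSeries.X) * (PowerSeries.mk periodDoubling +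
      PowerSeries.X * PowerSeries.mk periodDoubling ^ 2) = 1 := by
  have h : PowerSeries.mk periodDoubling + PowerSeries.X * PowerSeries.mk periodDoubling ^ 2 =
      PowerSeries.mk 1 := by
    rw [powerSeries_sq_eq_expand]
    ext n
    rw [map_add, PowerSeries.coeff_mk, PowerSeries.coeff_mk, Pi.one_apply]
    obtain ⟨s, rfl | rfl⟩ := Nat.even_or_odd' n
    · rw [periodDoubling_even]
      rcases s with - | s
      · simp
      · rw [show 2 * (s + 1) = (2 * s + 1) + 1 by ring, PowerSeries.coeff_succ_X_mul,
          PowerSeries.coeff_expand_of_not_dvd _ _ _ (by omega), add_zero]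
    · rw [periodDoubling_odd, PowerSeries.coeff_succ_X_mul, PowerSeries.coeff_expand_mul,
        PowerSeries.coeff_mk]
      linear_combination periodDoubling s * (CharTwo.two_eq_zero : (2 : ZMod 2) = 0)
  rw [h, mul_comm, PowerSeries.mk_one_mul_one_sub_eq_one]

/-- The series `∑ δ_k t ^ (-k - 1)` of the period-doubling sequence `δ` over the field with two
elements. -/
noncomputable def pdSeries : LaurentSeries (ZMod 2) :=
  HahnSeries.single (1 : ℤ) 1 * HahnSeries.ofPowerSeries ℤ (ZMod 2) (PowerSeries.mk periodDoubling)

theorem coeff_pdSeries (m : ℕ) : pdSeries.coeff ((m : ℤ) + 1) = periodDoubling m := by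
  have h := HahnSeries.coeff_single_mul_add (r := (1 : ZMod 2))
    (x := HahnSeries.ofPowerSeries ℤ (ZMod 2) (PowerSeries.mk periodDoubling))
    (a := (m : ℤ)) (b := 1)
  rw [pdSeries, h, one_mul, PowerSeries.coeff_coe, if_neg (by omega), Int.natAbs_natCast,
    PowerSeries.coeff_mk]

/-- `pdSeries` solves the Artin–Schreier equation `A ^ 2 + A = 1 / (t + 1)`. -/
theorem pdSeries_quadratic :
    ofPoly (X - C 1 : (ZMod 2)[X]) * (pdSeries ^ 2 + pdSeries) = 1 := by
  have h := congrArg (HahnSeries.ofPowerSeries ℤ (ZMod 2)) mk_periodDoubling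
  have h1 : ofPoly (X - C 1 : (ZMod 2)[X]) = tVar (ZMod 2) - 1 := by simp [ofPoly]
  have h2 : tVar (ZMod 2) * HahnSeries.single (1 : ℤ) 1 = 1 := by
    rw [tVar, HahnSeries.single_mul_single]
    norm_num
  rw [h1, pdSeries]
  rw [map_mul, map_sub, map_add, map_mul, map_pow, map_one, HahnSeries.ofPowerSeries_X] at h
  generalize HahnSeries.ofPowerSeries ℤ (ZMod 2) (PowerSeries.mk periodDoubling) = D at *
  generalize (HahnSeries.single (1 : ℤ) 1 : LaurentSeries (ZMod 2)) = z at *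
  linear_combination h + (D + z * D ^ 2) * h2

theorem coeff_mul_eq_zero {R : Type*} [CommRing R] {x y : LaurentSeries R} {a b c : ℤ}
    (hx : ∀ i < a, x.coeff i = 0) (hy : ∀ i < b, y.coeff i = 0) (h : c < a + b) :
    (x * y).coeff c = 0 := by
  rw [HahnSeries.coeff_mul]
  refine Finset.sum_eq_zero fun p hp => ?_
  have hp' := (Finset.mem_antidiagonal.1 hp).2.2
  rcases lt_or_ge p.1 a with h1 | h1
  · rw [hx _ h1, zero_mul]
  · rw [hy p.2 (by omega), mul_zero]

/-- The form `p² + (X - 1) p r + (X - 1) r²` is anisotropic: its dehomogenisation is an Eisenstein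
polynomial at `X - 1`. -/
theorem eq_zero_of_form_eq_zero {K : Type*} [Field K] (p r : K[X])
    (h : p ^ 2 + (X - C 1) * p * r + (X - C 1) * r ^ 2 = 0) : r = 0 := by
  induction hd : r.natDegree using Nat.strong_induction_on generalizing p r with
  | _ d ih =>
    have hpr : Prime (X - C 1 : K[X]) := prime_X_sub_C 1
    obtain ⟨p', rfl⟩ : (X - C 1 : K[X]) ∣ p :=
      hpr.dvd_of_dvd_pow (n := 2) ⟨-(p * r + r ^ 2), by linear_combination h⟩
    have h2 : (X - C 1) * p' ^ 2 + (X - C 1) * p' * r + r ^ 2 = 0 :=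
      mul_left_cancel₀ hpr.ne_zero (by linear_combination h)
    obtain ⟨r', rfl⟩ : (X - C 1 : K[X]) ∣ r :=
      hpr.dvd_of_dvd_pow (n := 2) ⟨-(p' ^ 2 + p' * r), by linear_combination h2⟩
    have h3 : p' ^ 2 + (X - C 1) * p' * r' + (X - C 1) * r' ^ 2 = 0 :=
      mul_left_cancel₀ hpr.ne_zero (by linear_combination h2)
    by_cases hr : r' = 0
    · rw [hr, mul_zero]
    · rw [natDegree_mul hpr.ne_zero hr, natDegree_X_sub_C] at hd
      exact absurd (ih _ (by omega) p' r' h3 rfl) hr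

theorem ofPoly_eq_zero {R : Type*} [CommRing R] {q : R[X]}
    (h : ∀ i : ℤ, i ≤ 0 → (ofPoly q).coeff i = 0) : q = 0 := by
  ext n
  rw [← coeff_ofPoly_neg, h _ (by omega), coeff_zero]

/-- Modulo two the approximations `q` of the period-doubling series that vanish at `1` are as bad as
possible: a better one makes the norm form of the quadratic extension generated by the series
vanish at `(p, r)`, where `q = (X - 1) r` and `p` is the polynomial part. -/
theorem eq_zero_of_pdSeries_approx {q : (ZMod 2)[X]} {d : ℕ} (hd : q.natDegree ≤ d)
    (h1 : q.IsRoot 1) (h : ∀ i < d, (ofPoly q * pdSeries).coeff ((i : ℤ) + 1) = 0) : q = 0 := by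
  obtain ⟨r, hr⟩ := dvd_iff_isRoot.2 h1
  obtain ⟨p, hp⟩ := exists_polyPart (ofPoly q * pdSeries)
  have he : ∀ i < (d : ℤ) + 1, (ofPoly q * pdSeries - ofPoly p).coeff i = 0 := by
    intro i hi
    rcases le_or_gt i 0 with h0 | h0
    · exact hp i h0
    · obtain ⟨n, rfl⟩ : ∃ n : ℕ, i = n + 1 := ⟨(i - 1).toNat, by omega⟩
      rw [HahnSeries.coeff_sub, coeff_ofPoly_of_pos p h0, sub_zero, h n (by omega)]
  have hq : ∀ i < -(d : ℤ), (ofPoly q).coeff i = 0 := by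
    intro i hi
    obtain ⟨n, rfl⟩ : ∃ n : ℕ, i = -(n : ℤ) := ⟨(-i).toNat, by omega⟩
    rw [coeff_ofPoly_neg, coeff_eq_zero_of_natDegree_lt (by omega)]
  have htwo : (2 : LaurentSeries (ZMod 2)) = 0 := by
    have := congrArg (HahnSeries.C (Γ := ℤ)) (CharTwo.two_eq_zero : (2 : ZMod 2) = 0)
    rwa [map_ofNat, map_zero] at this
  have hN : ofPoly (p ^ 2 + (X - C 1) * p * r + (X - C 1) * r ^ 2) =
      (ofPoly q * pdSeries - ofPoly p) * (ofPoly q * pdSeries - ofPoly p) +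
        ofPoly q * (ofPoly q * pdSeries - ofPoly p) := by
    have hA := pdSeries_quadratic
    rw [hr]
    simp only [pow_two, ofPoly_add, ofPoly_mul]
    generalize ofPoly (X - C 1 : (ZMod 2)[X]) = w at *
    linear_combination (-(w * ofPoly r ^ 2)) * hA +
      (w * ofPoly p * ofPoly r + w * ofPoly r * pdSeries * ofPoly p) * htwo
  have hN0 : p ^ 2 + (X - C 1) * p * r + (X - C 1) * r ^ 2 = 0 := by
    apply ofPoly_eq_zero
    intro i hi
    rw [hN, HahnSeries.coeff_add, coeff_mul_eq_zero he he (by omega),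
      coeff_mul_eq_zero hq he (by omega), add_zero]
  rw [hr, eq_zero_of_form_eq_zero p r hN0, mul_zero]

/-- A primitive integer vector cannot lie in the kernel of the `(d + 1) × (d + 1)` Hankel matrix of
the Thue–Morse signs: differences of consecutive rows are even, and halving them leaves a system
modulo two to which `eq_zero_of_pdSeries_approx` applies. -/
theorem exists_sum_ne_zero_of_isPrimitive {P : ℤ[X]} (hP : P.IsPrimitive) {d : ℕ}
    (hd : P.natDegree ≤ d) :
    ∃ i ≤ d, ∑ j ∈ Finset.range (d + 1), P.coeff j * (-1) ^ binOnes (i + j) ≠ 0 := by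
  by_contra! hc
  choose e he1 he2 using exists_half_diff
  set Q : (ZMod 2)[X] := P.map (Int.castRingHom (ZMod 2)) with hQ
  have hQd : Q.natDegree ≤ d := natDegree_map_le.trans hd
  have hroot : Q.IsRoot 1 := by
    have := congrArg (Int.cast : ℤ → ZMod 2) (hc 0 (Nat.zero_le _))
    push_cast at this
    have hneg : (-1 : ZMod 2) = 1 := rfl
    rw [IsRoot, eval_eq_sum_range' (Nat.lt_succ_of_le hQd), ← this]
    simp [hneg, hQ]
  have hco : ∀ i < d, (ofPoly Q * pdSeries).coeff ((i : ℤ) + 1) = 0 := by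
    intro i hi
    have h1 : (2 : ℤ) * ∑ j ∈ Finset.range (d + 1), P.coeff j * e (i + j) = 0 := by
      have h2 := hc i hi.le
      have h3 := hc (i + 1) hi
      calc _ = ∑ j ∈ Finset.range (d + 1), P.coeff j * (-1) ^ binOnes (i + j) -
          ∑ j ∈ Finset.range (d + 1), P.coeff j * (-1) ^ binOnes (i + 1 + j) := by
            rw [← Finset.sum_sub_distrib, Finset.mul_sum]
            refine Finset.sum_congr rfl fun j _ => ?_
            rw [add_right_comm i 1 j]
            linear_combination (-P.coeff j) * he1 (i + j)
        _ = 0 := by rw [h2, h3, sub_zero]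
    have h4 := congrArg (Int.cast : ℤ → ZMod 2)
      ((mul_eq_zero.1 h1).resolve_left two_ne_zero)
    push_cast at h4
    rw [coeff_ofPoly_mul (Nat.lt_succ_of_le hQd), ← h4]
    refine Finset.sum_congr rfl fun j _ => ?_
    rw [show (i : ℤ) + 1 + j = ((i + j : ℕ) : ℤ) + 1 by push_cast; ring, coeff_pdSeries, he2]
    simp [hQ]
  have hQ0 := eq_zero_of_pdSeries_approx hQd hroot hco
  have hdvd : C (2 : ℤ) ∣ P := by
    rw [C_dvd_iff_dvd_coeff]
    intro j
    have := congrArg (fun f => f.coeff j) hQ0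
    simp only [hQ, coeff_map, coeff_zero, eq_intCast] at this
    exact_mod_cast (ZMod.intCast_zmod_eq_zero_iff_dvd _ _).1 this
  exact absurd (hP _ hdvd) (by decide)

theorem exists_coeff_thueMorse_ne_zero {q : ℚ[X]} (hq : q ≠ 0) :
    ∃ i ≤ q.natDegree, (ofPoly q * gTM (-1 : ℚ)).coeff ((i : ℤ) + 1) ≠ 0 := by
  obtain ⟨b, hbm, hb⟩ := IsLocalization.integerNormalization_spec (nonZeroDivisors ℤ) q
  set P := IsLocalization.integerNormalization (nonZeroDivisors ℤ) q
  have hb0 : (b : ℚ) ≠ 0 := by exact_mod_cast nonZeroDivisors.ne_zero hbm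
  have hcoeff : ∀ j, ((P.coeff j : ℤ) : ℚ) = b * q.coeff j := by
    intro j
    have := congrArg (fun f => f.coeff j) hb
    simpa using this
  have hPc : ∀ j, P.coeff j = P.content * P.primPart.coeff j := by
    intro j
    conv_lhs => rw [P.eq_C_content_mul_primPart, coeff_C_mul]
  have hdeg : P.primPart.natDegree ≤ q.natDegree := by
    rw [natDegree_primPart, natDegree_le_iff_coeff_eq_zero]
    intro j hj
    have := hcoeff j
    rw [coeff_eq_zero_of_natDegree_lt hj, mul_zero] at this
    exact_mod_cast this
  have hP0 : P ≠ 0 := by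
    intro h
    apply hq
    ext j
    have := hcoeff j
    rw [h, coeff_zero, Int.cast_zero, eq_comm, mul_eq_zero] at this
    simpa using this.resolve_left hb0
  have hcont : (P.content : ℚ) ≠ 0 := by exact_mod_cast mt content_eq_zero_iff.1 hP0
  obtain ⟨i, hi, hne⟩ := exists_sum_ne_zero_of_isPrimitive P.isPrimitive_primPart hdeg
  refine ⟨i, hi, fun h0 => hne ?_⟩
  rw [coeff_ofPoly_mul (Nat.lt_succ_self _)] at h0
  have h1 : (P.content : ℚ) * ((∑ j ∈ Finset.range (q.natDegree + 1),
      P.primPart.coeff j * (-1) ^ binOnes (i + j) : ℤ) : ℚ) = b * 0 := by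
    rw [← h0, Int.cast_sum, Finset.mul_sum, Finset.mul_sum]
    refine Finset.sum_congr rfl fun j _ => ?_
    rw [show (i : ℤ) + 1 + j = ((i + j : ℕ) : ℤ) + 1 by push_cast; ring, coeff_gTM,
      ← mul_assoc (b : ℚ), ← hcoeff, hPc]
    push_cast
    ring
  rw [mul_zero] at h1
  exact_mod_cast (mul_eq_zero.1 h1).resolve_left hcont

theorem thueMorse_mem_Badδ : gTM (-1 : ℚ) ∈ Badδ ℚ (1 / 2) := by
  rw [Badδ, Set.mem_ofPred_eq, badLiminf]
  refine Filter.le_liminf_of_le (by isBoundedDefault) ?_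
  have h1 : ∀ᶠ q : ℚ[X] in Filter.comap (fun q : ℚ[X] => q.natDegree) Filter.atTop,
      1 ≤ q.natDegree := Filter.tendsto_comap.eventually (Filter.eventually_ge_atTop 1)
  filter_upwards [h1] with q hq
  have hq0 : q ≠ 0 := by
    rintro rfl
    simp at hq
  exact_mod_cast half_le_absVal_mul_distPoly hq0 (exists_coeff_thueMorse_ne_zero hq0)

end TAdicLittlewood

theorem theorem2 :
    (∀ u : ℚ, u ≠ 0 → u ≠ 1 → u ≠ -1 → gTM u ∈ ELCδ ℚ (1 / 2)) ∧
    (gTM (-1 : ℚ) ∈ Badδ ℚ (1 / 2) ∧ gTM (-1 : ℚ) ∉ ELC ℚ) ∧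
    (∀ (n l : ℕ), 1 ≤ n → ∃ D : Polynomial ℤ,
      (∀ u : ℚ, (hankel (gTM u) (n : ℤ) l).det = Polynomial.aeval u D) ∧
      DoublyMonic D ∧
      (D.natDegree : ℤ) = sigmaOnes l + sigmaOnes ((n : ℤ) + l - 1) - sigmaOnes ((n : ℤ) - 2)) := by
  refine ⟨fun u => gTM_mem_ELCδ, ⟨thueMorse_mem_Badδ, thueMorse_notMem_ELC⟩, fun n l hn => ?_⟩
  obtain ⟨m, rfl⟩ : ∃ m, n = m + 1 := ⟨n - 1, by omega⟩
  refine ⟨(genHankel m (l + 1)).det, fun u => ?_, doublyMonic_det_genHankel m l, ?_⟩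
  · exact_mod_cast det_hankel_gTM u m l
  · rw [natDegree_det_genHankel, hankelDegree, sum_binOnes]
    push_cast
    rw [show (m : ℤ) + 1 + l - 1 = m + l by ring, show (m : ℤ) + 1 - 2 = m - 1 by ring]
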